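/- Let $n\ge 3$, orient the edges of the complete graph $K_n$ independently, each with probability $\tfrac12$ in either direction (that is, take a uniformly random orientation of $K_n$), and let $a,s,b$ be three distinct vertices. Write $\{u\to v\}$ for the event that there is a directed path from $u$ to $v$, and $\{u\nrightarrow v\}$ for the complementary event. Call events $E,F$ negatively correlated if $P(E\cap F)<P(E)P(F)$ and positively correlated if $P(E\cap F)>P(E)P(F)$. Then the events $A=\{a\nrightarrow s\}$ and $B=\{s\nrightarrow b\}$ are negatively correlated if $n=3$, independent if $n=4$, and positively correlated if $n\ge5$. The same holds for the complementary events $\{a\to s\}$ and $\{s\to b\}$: they are negatively correlated if $n=3$, independent if $n=4$, and positively correlated if $n\ge 5$. -/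

import Mathlib

open MeasureTheory ProbabilityTheory

noncomputable section

/-- The complete graph on `n` vertices. -/
abbrev K (n : ℕ) : SimpleGraph (Fin n) := ⊤

/-- The two possible heads of an unordered edge `e`, i.e. its endpoints. -/
def Head {V : Type*} {G : SimpleGraph V} (e : G.edgeSet) : Type _ :=
  {v : V // v ∈ (e : Sym2 V)}

instance {V : Type*} {G : SimpleGraph V} (e : G.edgeSet) : MeasurableSpace (Head e) := ⊤

/-- An orientation of `G`: every edge is given a direction, by choosing which of its two
endpoints is the head. -/
abbrev EdgeOrientation {V : Type*} (G : SimpleGraph V) : Type _ :=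
  (e : G.edgeSet) → Head e

/-- The edge `{u, v}` is present and is directed from `u` to `v`. -/
def EdgeOrientation.Arc {V : Type*} {G : SimpleGraph V} (ω : EdgeOrientation G)
    (u v : V) : Prop :=
  ∃ h : G.Adj u v, (ω ⟨s(u, v), h⟩).1 = v

/-- The law of the random orientation: the edges are oriented independently, each of them
with equal probability in either direction. -/
def randomOrientation {V : Type*} (G : SimpleGraph V) [Fintype G.edgeSet] :
    Measure (EdgeOrientation G) :=
  Measure.pi fun e : G.edgeSet => (uniformOn Set.univ : Measure (Head e))

/-- The event that there is a directed path from `u` to `v`. -/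
def pathEvent {V : Type*} (G : SimpleGraph V) (u v : V) : Set (EdgeOrientation G) :=
  {ω | Relation.ReflTransGen ω.Arc u v}

/-- The event that there is no directed path from `u` to `v`. -/
def noPathEvent {V : Type*} (G : SimpleGraph V) (u v : V) : Set (EdgeOrientation G) :=
  {ω | ¬ Relation.ReflTransGen ω.Arc u v}

def NegativelyCorrelated {Ω : Type*} [MeasurableSpace Ω] (P : Measure Ω) (E F : Set Ω) : Prop :=
  P.real (E ∩ F) < P.real E * P.real F

def PositivelyCorrelated {Ω : Type*} [MeasurableSpace Ω] (P : Measure Ω) (E F : Set Ω) : Prop :=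
  P.real E * P.real F < P.real (E ∩ F)

end

/-! Explore from `a`: if `C` is the set of vertices that `a` reaches, every edge between `C` and its
complement points into `C`. Conversely, that condition together with `a` spanning `C` makes `C` the
cluster (`clusterEvent_eq`). The two conditions involve disjoint sets of edges, so summing over `C`
expresses P(A) through the spanning probabilities, which satisfy a recursion of the same kind.

On A ∩ B the cluster of `a` also misses `b`: otherwise the arc `b → s` forced by B would give `a →
s`. As nothing leaves `C`, whether `s` reaches `b` is decided by the edges outside `C`, which are
independent of the cluster event. This gives an exact formula for P(A ∩ B)
(`real_not_reachIn_inter`).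

The formulas are rational, so small `n` is a computation. For large `n`, P(A) is about 2 · 2^-(n-1)
(`a` is a sink or `s` is a source), while three configurations give P(A ∩ B) at least about 3 ·
2^-(2n-3), which exceeds P(A)P(B) by a factor near 3/2. `sq_noReachProb_lt` makes this explicit.
Passing to complements preserves the covariance, which settles the path events. -/

/-! ### The product measure -/

section Product

variable {V : Type*} {G : SimpleGraph V}

instance (e : G.edgeSet) : DiscreteMeasurableSpace (Head e) := ⟨fun _ => trivial⟩

lemma card_head (e : G.edgeSet) : Nat.card (Head e) = 2 := by
  obtain ⟨e, he⟩ := e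
  induction e with
  | h u v =>
    have huv : u ≠ v := G.ne_of_adj he
    have : Nat.card (Head (⟨s(u, v), he⟩ : G.edgeSet)) = ({u, v} : Set V).ncard := by
      rw [← Nat.card_coe_set_eq]
      exact Nat.card_congr (Equiv.subtypeEquivRight fun w => by simp)
    rw [this, Set.ncard_pair huv]

instance (e : G.edgeSet) : Finite (Head e) :=
  Nat.finite_of_card_ne_zero (by simp [card_head])

instance (e : G.edgeSet) : Nonempty (Head e) :=
  (Nat.card_pos_iff.1 (by simp [card_head])).1

lemma uniformOn_head_singleton (e : G.edgeSet) (h : Head e) :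
    (uniformOn Set.univ : Measure (Head e)).real {h} = 1 / 2 := by
  classical
  have := Fintype.ofFinite (Head e)
  rw [Measure.real, uniformOn_univ, Measure.count_singleton, ← Nat.card_eq_fintype_card,
    card_head]
  simp

variable [Fintype G.edgeSet]

instance : IsProbabilityMeasure (randomOrientation G) := by
  unfold randomOrientation; infer_instance

lemma measurableSet_orientation (E : Set (EdgeOrientation G)) : MeasurableSet E :=
  E.toFinite.measurableSet

/-- Events depending on disjoint sets of edges are independent. -/
lemma real_inter_of_dependsOn {E F : Set (EdgeOrientation G)} {S T : Set G.edgeSet}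
    (hE : DependsOn (· ∈ E) S) (hF : DependsOn (· ∈ F) T) (hST : Disjoint S T) :
    (randomOrientation G).real (E ∩ F)
      = (randomOrientation G).real E * (randomOrientation G).real F := by
  classical
  have hind : iIndepFun (fun (e : G.edgeSet) (ω : EdgeOrientation G) => ω e)
      (randomOrientation G) :=
    iIndepFun_pi (X := fun _ => id) (fun _ => aemeasurable_id)
  have h2 := hind.indepFun_finset S.toFinset T.toFinset
    (by simpa using hST) (fun e => measurable_pi_apply e)
  -- An event determined by the coordinates in `S` is the preimage of its own image under
  -- restriction to `S`.
  have key : ∀ {E : Set (EdgeOrientation G)} {S : Set G.edgeSet}, DependsOn (· ∈ E) S →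
      (fun ω (i : S.toFinset) => ω i) ⁻¹' ((fun ω (i : S.toFinset) => ω i.1) '' E) = E := by
    intro E S h
    ext ω
    constructor
    · rintro ⟨ω', h', heq⟩
      refine (h (x := ω') (y := ω) fun i hi => ?_).mp h'
      exact congrFun heq ⟨i, by simpa using hi⟩
    · exact fun h => ⟨ω, h, rfl⟩
  have := h2.measure_inter_preimage_eq_mul _ _
    ((fun ω (i : S.toFinset) => ω i.1) '' E).toFinite.measurableSet
    ((fun ω (i : T.toFinset) => ω i.1) '' F).toFinite.measurableSet
  rw [key hE, key hF] at this
  simp [Measure.real, this]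

end Product

section DependsOn

variable {ι : Type*} {α : ι → Type*}

lemma DependsOn.mem_inter {E F : Set (Π i, α i)} {S T : Set ι} (hE : DependsOn (· ∈ E) S)
    (hF : DependsOn (· ∈ F) T) : DependsOn (· ∈ E ∩ F) (S ∪ T) := by
  intro x y h
  have h1 := hE (x := x) (y := y) fun i hi => h i (Or.inl hi)
  have h2 := hF (x := x) (y := y) fun i hi => h i (Or.inr hi)
  simp_all [Set.mem_inter_iff]

end DependsOn

/-! ### Complete graphs -/

section Tournament

variable {V : Type*}

/-- The edges of the complete graph with both ends in `S`. -/
def innerEdges (S : Finset V) : Set (⊤ : SimpleGraph V).edgeSet :=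
  {e | ∀ v ∈ (e : Sym2 V), v ∈ S}

/-- The edges of the complete graph with one end in `S` and the other in `T`. -/
def crossEdges (S T : Finset V) : Set (⊤ : SimpleGraph V).edgeSet :=
  {e | ∃ u ∈ S, ∃ v ∈ T, (e : Sym2 V) = s(v, u)}

lemma disjoint_innerEdges {S T : Finset V} (h : Disjoint S T) :
    Disjoint (innerEdges S) (innerEdges T) := by
  rw [Set.disjoint_left]
  rintro ⟨e, he⟩ h1 h2
  induction e with
  | h u v => exact Finset.disjoint_left.1 h (h1 u (by simp)) (h2 u (by simp))

lemma disjoint_innerEdges_crossEdges_left {S T U : Finset V} (h : Disjoint S U) :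
    Disjoint (innerEdges S) (crossEdges T U) := by
  rw [Set.disjoint_left]
  rintro ⟨e, he⟩ h1 ⟨u, hu, v, hv, rfl⟩
  exact Finset.disjoint_left.1 h (h1 v (by simp)) hv

lemma disjoint_innerEdges_crossEdges_right {S T U : Finset V} (h : Disjoint S T) :
    Disjoint (innerEdges S) (crossEdges T U) := by
  rw [Set.disjoint_left]
  rintro ⟨e, he⟩ h1 ⟨u, hu, v, hv, rfl⟩
  exact Finset.disjoint_left.1 h (h1 u (by simp)) hu

variable {ω : EdgeOrientation (⊤ : SimpleGraph V)} {u v : V}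

lemma EdgeOrientation.Arc.not_arc (h : ω.Arc u v) : ¬ ω.Arc v u := by
  rintro ⟨h', h2⟩
  obtain ⟨h1, h3⟩ := h
  have : (⟨s(v, u), h'⟩ : (⊤ : SimpleGraph V).edgeSet) = ⟨s(u, v), h1⟩ :=
    Subtype.ext Sym2.eq_swap
  rw [this, h3] at h2
  exact h1.ne' h2

lemma EdgeOrientation.arc_or_arc (huv : u ≠ v) : ω.Arc u v ∨ ω.Arc v u := by
  have h1 : (⊤ : SimpleGraph V).Adj u v := huv
  have h2 : (⊤ : SimpleGraph V).Adj v u := huv.symm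
  have h3 := (ω ⟨s(u, v), h1⟩).2
  rw [Sym2.mem_iff] at h3
  rcases h3 with h3 | h3
  · right
    refine ⟨h2, ?_⟩
    have : (⟨s(v, u), h2⟩ : (⊤ : SimpleGraph V).edgeSet) = ⟨s(u, v), h1⟩ :=
      Subtype.ext Sym2.eq_swap
    rw [this, h3]
  · exact Or.inl ⟨h1, h3⟩

/-- All edges between `S` and `T` are directed from `T` to `S`. -/
def intoEvent (S T : Finset V) : Set (EdgeOrientation (⊤ : SimpleGraph V)) :=
  {ω | ∀ u ∈ S, ∀ v ∈ T, ω.Arc v u}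

lemma arc_congr {ω ω' : EdgeOrientation (⊤ : SimpleGraph V)}
    (h : ∀ h : u ≠ v, ω ⟨s(u, v), h⟩ = ω' ⟨s(u, v), h⟩) : ω.Arc u v ↔ ω'.Arc u v := by
  constructor
  · rintro ⟨h1, h2⟩
    exact ⟨h1, h h1 ▸ h2⟩
  · rintro ⟨h1, h2⟩
    exact ⟨h1, (h h1).symm ▸ h2⟩

lemma dependsOn_intoEvent (S T : Finset V) :
    DependsOn (· ∈ intoEvent S T) (crossEdges S T) := by
  intro ω ω' h
  refine propext (forall₄_congr fun u hu v hv => arc_congr fun h' => h _ ?_)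
  exact ⟨u, hu, v, hv, rfl⟩

variable [Fintype (⊤ : SimpleGraph V).edgeSet]

/-- The event is a box in the product space: each cross edge has one of its two heads forced, and
the other edges are free. Disjointness keeps the demands on an edge consistent and makes the pairs
in `S ×ˢ T` give distinct edges. -/
lemma real_intoEvent {S T : Finset V} (h : Disjoint S T) :
    (randomOrientation (⊤ : SimpleGraph V)).real (intoEvent S T)
      = (1 / 2) ^ (S.card * T.card) := by
  classical
  have hset : intoEvent S T = Set.pi Set.univ
      fun e => {h : Head e | ∀ u ∈ S, ∀ v ∈ T, (e : Sym2 V) = s(v, u) → h.1 = u} := by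
    ext ω
    simp only [intoEvent, Set.mem_ofPred_eq, Set.mem_pi, Set.mem_univ, true_imp_iff]
    constructor
    · rintro hω ⟨e, he⟩ u hu v hv rfl
      exact (hω u hu v hv).2
    · intro hω u hu v hv
      have hne : v ≠ u := fun h' => Finset.disjoint_left.1 h hu (h' ▸ hv)
      exact ⟨hne, hω ⟨s(v, u), hne⟩ u hu v hv rfl⟩
  have hcard : S.card * T.card = (Finset.univ.filter (· ∈ crossEdges S T)).card := by
    rw [← Finset.card_product]
    have hne : ∀ p ∈ S ×ˢ T, p.2 ≠ p.1 := fun p hp h' => by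
      rw [Finset.mem_product] at hp
      exact Finset.disjoint_left.1 h hp.1 (h' ▸ hp.2)
    refine Finset.card_bij (fun p hp => ⟨s(p.2, p.1), hne p hp⟩) ?_ ?_ ?_
    · rintro ⟨u, v⟩ hp
      rw [Finset.mem_product] at hp
      simpa using ⟨u, hp.1, v, hp.2, rfl⟩
    · rintro ⟨u, v⟩ hp ⟨u', v'⟩ hp' heq
      rw [Finset.mem_product] at hp hp'
      rcases Sym2.eq_iff.1 (congrArg Subtype.val heq) with ⟨rfl, rfl⟩ | ⟨rfl, rfl⟩
      · rfl
      · exact (Finset.disjoint_left.1 h hp'.1 hp.2).elim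
    · rintro ⟨e, he⟩ hm
      obtain ⟨u, hu, v, hv, rfl⟩ := (Finset.mem_filter.1 hm).2
      exact ⟨(u, v), Finset.mem_product.2 ⟨hu, hv⟩, rfl⟩
  have hfac : ∀ e : (⊤ : SimpleGraph V).edgeSet, (uniformOn Set.univ : Measure (Head e)).real
      {h : Head e | ∀ u ∈ S, ∀ v ∈ T, (e : Sym2 V) = s(v, u) → h.1 = u}
        = if e ∈ crossEdges S T then 1 / 2 else 1 := by
    intro e
    split_ifs with he
    · obtain ⟨e, he'⟩ := e
      obtain ⟨u, hu, v, hv, rfl⟩ := he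
      rw [← uniformOn_head_singleton ⟨s(v, u), he'⟩ ⟨u, by simp⟩]
      congr 1
      ext x
      constructor
      · exact fun hx => Subtype.ext (hx u hu v hv rfl)
      · rintro rfl u' hu' v' hv' heq
        rcases Sym2.eq_iff.1 heq with ⟨rfl, rfl⟩ | ⟨rfl, rfl⟩
        · rfl
        · exact (Finset.disjoint_left.1 h hu' hv).elim
    · have : {h : Head e | ∀ u ∈ S, ∀ v ∈ T, (e : Sym2 V) = s(v, u) → h.1 = u} = Set.univ :=
        Set.eq_univ_of_forall fun x u hu v hv h' => (he ⟨u, hu, v, hv, h'⟩).elim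
      rw [this, probReal_univ]
  rw [hset, randomOrientation, Measure.real, Measure.pi_pi, ENNReal.toReal_prod, hcard]
  change ∏ e, (uniformOn Set.univ : Measure (Head e)).real _ = _
  rw [Finset.prod_congr rfl fun e _ => hfac e, Finset.prod_ite]
  simp

end Tournament

/-! ### Reachability inside a set of vertices -/

section Reach

variable {V : Type*}

/-- There is a directed path from `x` to `y` with all its arcs inside `S`. -/
def EdgeOrientation.ReachIn (ω : EdgeOrientation (⊤ : SimpleGraph V)) (S : Finset V) (x y : V) :
    Prop :=
  Relation.ReflTransGen (fun u v => u ∈ S ∧ v ∈ S ∧ ω.Arc u v) x y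

/-- The vertex `x` reaches all vertices of `S` inside `S`. -/
def spanEvent (S : Finset V) (x : V) : Set (EdgeOrientation (⊤ : SimpleGraph V)) :=
  {ω | ∀ y ∈ S, ω.ReachIn S x y}

lemma reachIn_congr {S : Finset V} {ω ω' : EdgeOrientation (⊤ : SimpleGraph V)}
    (h : ∀ e ∈ innerEdges S, ω e = ω' e) (x y : V) : ω.ReachIn S x y ↔ ω'.ReachIn S x y := by
  have : (fun u v => u ∈ S ∧ v ∈ S ∧ ω.Arc u v) = fun u v => u ∈ S ∧ v ∈ S ∧ ω'.Arc u v := by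
    funext u v
    refine propext (and_congr_right fun hu => and_congr_right fun hv => arc_congr fun h' => h _ ?_)
    intro w hw
    rcases Sym2.mem_iff.1 hw with rfl | rfl <;> assumption
  rw [EdgeOrientation.ReachIn, this, EdgeOrientation.ReachIn]

lemma dependsOn_spanEvent (S : Finset V) (x : V) :
    DependsOn (· ∈ spanEvent S x) (innerEdges S) := by
  intro ω ω' h
  exact propext (forall₂_congr fun y _ => reachIn_congr h x y)

lemma dependsOn_not_reachIn (S : Finset V) (x y : V) :
    DependsOn (· ∈ {ω : EdgeOrientation (⊤ : SimpleGraph V) | ¬ ω.ReachIn S x y})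
      (innerEdges S) := by
  intro ω ω' h
  exact propext (not_congr (reachIn_congr h x y))

lemma EdgeOrientation.ReachIn.mono {S T : Finset V} (hST : S ⊆ T)
    {ω : EdgeOrientation (⊤ : SimpleGraph V)} {x y : V} (h : ω.ReachIn S x y) :
    ω.ReachIn T x y :=
  Relation.ReflTransGen.mono (fun _ _ h => ⟨hST h.1, hST h.2.1, h.2.2⟩) _ _ h

lemma EdgeOrientation.ReachIn.mem {S : Finset V} {ω : EdgeOrientation (⊤ : SimpleGraph V)}
    {x y : V} (h : ω.ReachIn S x y) (hx : x ∈ S) : y ∈ S := by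
  induction h with
  | refl => exact hx
  | tail _ h _ => exact h.2.1

lemma reachIn_univ [Fintype V] {ω : EdgeOrientation (⊤ : SimpleGraph V)} {x y : V} :
    ω.ReachIn Finset.univ x y ↔ Relation.ReflTransGen ω.Arc x y := by
  simp [EdgeOrientation.ReachIn]

variable [DecidableEq V]

/-- The set of vertices of `S` reached by `x` inside `S` is `C`. -/
def clusterEvent (S : Finset V) (x : V) (C : Finset V) :
    Set (EdgeOrientation (⊤ : SimpleGraph V)) :=
  {ω | ∀ y, ω.ReachIn S x y ↔ y ∈ C}

/-- All arcs between `C` and its complement in `S` point into `C`, so nothing leaves `C`. -/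
lemma mem_of_reachIn {S C : Finset V} {ω : EdgeOrientation (⊤ : SimpleGraph V)}
    (h : ω ∈ intoEvent C (S \ C)) {x y : V} (hx : x ∈ C) (hxy : ω.ReachIn S x y) : y ∈ C := by
  induction hxy with
  | refl => exact hx
  | tail _ harc ih =>
    by_contra hz
    exact harc.2.2.not_arc (h _ ih _ (Finset.mem_sdiff.2 ⟨harc.2.1, hz⟩))

/-- An arc leaving `C` would enlarge the cluster, and every vertex on a path from `x` is itself in
the cluster, so the path stays in `C`. -/
lemma clusterEvent_eq {S C : Finset V} {x : V} (hx : x ∈ C) (hC : C ⊆ S) :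
    clusterEvent S x C = spanEvent C x ∩ intoEvent C (S \ C) := by
  ext ω
  constructor
  · intro h
    refine ⟨fun y hy => ?_, fun u hu v hv => ?_⟩
    · have hy' := (h y).2 hy
      clear hy
      induction hy' with
      | refl => exact Relation.ReflTransGen.refl
      | tail hz harc ih =>
        exact ih.tail ⟨(h _).1 hz, (h _).1 (hz.tail harc), harc.2.2⟩
    · rw [Finset.mem_sdiff] at hv
      have hne : u ≠ v := fun h' => hv.2 (h' ▸ hu)
      refine (EdgeOrientation.arc_or_arc hne).resolve_left fun harc => hv.2 ?_
      exact (h v).1 (((h u).2 hu).tail ⟨hC hu, hv.1, harc⟩)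
  · rintro ⟨h1, h2⟩ y
    exact ⟨mem_of_reachIn h2 hx, fun hy => (h1 y hy).mono hC⟩

/-- No arc leaves `C`, so a path ending outside `C` never visited it. -/
lemma reachIn_sdiff_iff [Fintype V] {C : Finset V} {ω : EdgeOrientation (⊤ : SimpleGraph V)}
    (h : ω ∈ intoEvent C (Finset.univ \ C)) {x y : V} (hy : y ∉ C) :
    ω.ReachIn Finset.univ x y ↔ ω.ReachIn (Finset.univ \ C) x y := by
  refine ⟨fun hxy => ?_, fun hxy => hxy.mono (Finset.subset_univ _)⟩
  induction hxy with
  | refl => exact Relation.ReflTransGen.refl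
  | @tail u v _ harc ih =>
    have hu : u ∉ C := fun hu => harc.2.2.not_arc (h u hu v (by simpa using hy))
    exact (ih hu).tail ⟨by simpa using hu, by simpa using hy, harc.2.2⟩

variable [Fintype (⊤ : SimpleGraph V).edgeSet]

local notation "Pr" => randomOrientation (⊤ : SimpleGraph V)

lemma real_clusterEvent {S C : Finset V} {x : V} (hx : x ∈ C) (hC : C ⊆ S) :
    (Pr).real (clusterEvent S x C)
      = (Pr).real (spanEvent C x) * (1 / 2) ^ (C.card * (S \ C).card) := by
  rw [clusterEvent_eq hx hC, real_inter_of_dependsOn (dependsOn_spanEvent C x)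
    (dependsOn_intoEvent C (S \ C)) (disjoint_innerEdges_crossEdges_left Finset.disjoint_sdiff),
    real_intoEvent Finset.disjoint_sdiff]

/-- Decomposition of an event according to the cluster of `x`. -/
lemma real_eq_sum_cluster {S T : Finset V} {x : V} (hxT : x ∉ T)
    {E : Set (EdgeOrientation (⊤ : SimpleGraph V))}
    (hE : ∀ ω ∈ E, ∀ y, ω.ReachIn S x y → y ∈ insert x T) :
    (Pr).real E = ∑ R ∈ T.powerset, (Pr).real (E ∩ clusterEvent S x (insert x R)) := by
  classical
  have hU : E = ⋃ R ∈ T.powerset, E ∩ clusterEvent S x (insert x R) := by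
    ext ω
    simp only [Set.mem_iUnion, Set.mem_inter_iff, exists_prop]
    refine ⟨fun h => ?_, fun ⟨_, _, h, _⟩ => h⟩
    refine ⟨T.filter (ω.ReachIn S x), by simp, h, fun y => ?_⟩
    rw [Finset.mem_insert, Finset.mem_filter]
    constructor
    · intro hy
      rcases Finset.mem_insert.1 (hE ω h y hy) with h' | h'
      · exact Or.inl h'
      · exact Or.inr ⟨h', hy⟩
    · rintro (rfl | hy)
      · exact Relation.ReflTransGen.refl
      · exact hy.2
  conv_lhs => rw [hU]
  refine measureReal_biUnion_finset ?_ fun _ _ => measurableSet_orientation _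
  intro R hR R' hR' hne
  refine Set.disjoint_left.2 fun ω h h' => hne ?_
  rw [Finset.mem_coe, Finset.mem_powerset] at hR hR'
  have : insert x R = insert x R' := by
    ext y; rw [← h.2 y, ← h'.2 y]
  rw [← Finset.erase_insert (fun h => hxT (hR h)), this,
    Finset.erase_insert (fun h => hxT (hR' h))]

end Reach

/-! ### The numbers -/

/-- The probability that a given vertex of a random tournament on `m + 1` vertices reaches all
vertices. -/
def spanProb (m : ℕ) : ℚ :=
  1 - ∑ k : Fin m, m.choose k * (spanProb k * (1 / 2) ^ ((k.1 + 1) * (m - k)))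

/-- The probability that a given vertex of a random tournament on `m + 2` vertices does not
reach another given vertex. -/
def noReachProb (m : ℕ) : ℚ :=
  ∑ k ∈ Finset.range (m + 1), m.choose k * (spanProb k * (1 / 2) ^ ((k + 1) * (m + 1 - k)))

/-- The probability that in a random tournament on `m + 3` vertices with three given vertices
`a`, `s`, `b` there is neither a path from `a` to `s` nor one from `s` to `b`. -/
def noReachNoReachProb (m : ℕ) : ℚ :=
  ∑ k ∈ Finset.range (m + 1),
    m.choose k * (spanProb k * (1 / 2) ^ ((k + 1) * (m + 2 - k)) * noReachProb (m - k))

section Formulas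

variable {V : Type*} [DecidableEq V] [Fintype (⊤ : SimpleGraph V).edgeSet]

local notation "Pr" => randomOrientation (⊤ : SimpleGraph V)

/-- The cluster probabilities of `x` sum to 1. The full cluster contributes the unknown, and proper
clusters are covered by induction. -/
lemma real_spanEvent (T : Finset V) (x : V) (hx : x ∉ T) :
    (Pr).real (spanEvent (insert x T) x) = spanProb T.card := by
  induction T using Finset.strongInduction with
  | H T ih =>
  have h1 : ∀ R ∈ T.powerset, (Pr).real (Set.univ ∩ clusterEvent (insert x T) x (insert x R))
      = (Pr).real (spanEvent (insert x R) x) * (1 / 2) ^ ((R.card + 1) * (T.card - R.card)) := by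
    intro R hR
    rw [Finset.mem_powerset] at hR
    have hxR : x ∉ R := fun h => hx (hR h)
    rw [Set.univ_inter, real_clusterEvent (Finset.mem_insert_self x R)
      (Finset.insert_subset_insert x hR),
      Finset.card_sdiff_of_subset (Finset.insert_subset_insert x hR),
      Finset.card_insert_of_notMem hxR, Finset.card_insert_of_notMem hx, Nat.add_sub_add_right]
  have h2 := real_eq_sum_cluster (S := insert x T) hx (E := Set.univ)
    fun ω _ y hy => hy.mem (Finset.mem_insert_self x T)
  rw [probReal_univ, Finset.sum_congr rfl h1,
    ← Finset.sum_erase_add _ _ (Finset.mem_powerset_self T)] at h2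
  have h3 : ∑ R ∈ T.powerset.erase T, (Pr).real (spanEvent (insert x R) x) *
        (1 / 2) ^ ((R.card + 1) * (T.card - R.card))
      = ∑ R ∈ T.powerset.erase T, (spanProb R.card : ℝ) *
        (1 / 2) ^ ((R.card + 1) * (T.card - R.card)) := by
    refine Finset.sum_congr rfl fun R hR => ?_
    rw [Finset.mem_erase, Finset.mem_powerset] at hR
    rw [ih R (hR.2.ssubset_of_ne hR.1) (fun h => hx (hR.2 h))]
  have h4 := Finset.sum_powerset_apply_card (fun k => (spanProb k : ℝ) *
    (1 / 2) ^ ((k + 1) * (T.card - k))) (x := T)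
  rw [← Finset.sum_erase_add _ _ (Finset.mem_powerset_self T), Finset.sum_range_succ] at h4
  rw [h3] at h2
  rw [spanProb]
  push_cast
  rw [Fin.sum_univ_eq_sum_range (fun k => (T.card.choose k : ℝ) * ((spanProb k : ℝ) *
    (1 / 2) ^ ((k + 1) * (T.card - k)))) T.card]
  simp only [Nat.sub_self, mul_zero, pow_zero, mul_one, nsmul_eq_mul, Nat.choose_self,
    Nat.cast_one, one_mul] at h4 h2 ⊢
  linarith

lemma real_not_reachIn {S : Finset V} {x y : V} (hx : x ∈ S) (hy : y ∈ S) (hxy : x ≠ y) {m : ℕ}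
    (hm : S.card = m + 2) : (Pr).real {ω | ¬ ω.ReachIn S x y} = noReachProb m := by
  have hxT : x ∉ S \ {x, y} := by simp
  have hT : (S \ {x, y}).card = m := by
    rw [Finset.card_sdiff_of_subset (by simp [Finset.insert_subset_iff, hx, hy]),
      Finset.card_pair hxy, hm, Nat.add_sub_cancel]
  have h1 : ∀ R ∈ (S \ {x, y}).powerset,
      (Pr).real ({ω | ¬ ω.ReachIn S x y} ∩ clusterEvent S x (insert x R))
      = spanProb R.card * (1 / 2) ^ ((R.card + 1) * (m + 1 - R.card)) := by
    intro R hR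
    rw [Finset.mem_powerset] at hR
    have hxR : x ∉ R := fun h => hxT (hR h)
    have hyR : y ∉ insert x R := fun h => by
      rcases Finset.mem_insert.1 h with h | h
      · exact hxy h.symm
      · simpa using hR h
    have hS : insert x R ⊆ S :=
      Finset.insert_subset hx (hR.trans Finset.sdiff_subset)
    have hsub : clusterEvent S x (insert x R) ⊆ {ω | ¬ ω.ReachIn S x y} :=
      fun ω hω h => hyR ((hω y).1 h)
    rw [Set.inter_eq_right.2 hsub,
      real_clusterEvent (Finset.mem_insert_self x R) hS, real_spanEvent R x hxR,
      Finset.card_sdiff_of_subset hS, Finset.card_insert_of_notMem hxR, hm,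
      show m + 2 - (R.card + 1) = m + 1 - R.card by lia]
  rw [real_eq_sum_cluster (S := S) hxT, Finset.sum_congr rfl h1,
    Finset.sum_powerset_apply_card
      (fun k => (spanProb k : ℝ) * (1 / 2) ^ ((k + 1) * (m + 1 - k))), hT, noReachProb]
  · push_cast
    simp [nsmul_eq_mul]
  · intro ω hω z hz
    rw [Finset.mem_insert, Finset.mem_sdiff]
    by_cases hzx : z = x
    · exact Or.inl hzx
    · refine Or.inr ⟨hz.mem hx, ?_⟩
      have : z ≠ y := fun h => hω (h ▸ hz)
      simp [hzx, this]

/-- Given a cluster `insert a R` avoiding `s` and `b`, what remains is an independent random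
tournament on the other `m + 2 - R.card` vertices, in which `s` must not reach `b`. -/
lemma real_not_reachIn_inter [Fintype V] {a s b : V} (has : a ≠ s) (hsb : s ≠ b) (hab : a ≠ b)
    {m : ℕ} (hm : Fintype.card V = m + 3) :
    (Pr).real ({ω | ¬ ω.ReachIn Finset.univ a s} ∩ {ω | ¬ ω.ReachIn Finset.univ s b})
      = noReachNoReachProb m := by
  have haT : a ∉ (Finset.univ \ {a, s, b} : Finset V) := by simp
  have hT : (Finset.univ \ {a, s, b} : Finset V).card = m := by
    rw [Finset.card_sdiff_of_subset (Finset.subset_univ _), Finset.card_univ, hm,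
      Finset.card_eq_three.2 ⟨a, s, b, has, hab, hsb, rfl⟩, Nat.add_sub_cancel]
  have h1 : ∀ R ∈ (Finset.univ \ {a, s, b} : Finset V).powerset,
      (Pr).real (({ω | ¬ ω.ReachIn Finset.univ a s} ∩ {ω | ¬ ω.ReachIn Finset.univ s b}) ∩
        clusterEvent Finset.univ a (insert a R))
      = spanProb R.card * (1 / 2) ^ ((R.card + 1) * (m + 2 - R.card))
        * noReachProb (m - R.card) := by
    intro R hR
    rw [Finset.mem_powerset] at hR
    have hRm : R.card ≤ m := hT ▸ Finset.card_le_card hR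
    have haR : a ∉ R := fun h => haT (hR h)
    have hsR : s ∉ insert a R := fun h => by
      rcases Finset.mem_insert.1 h with h | h
      · exact has h.symm
      · simpa using hR h
    have hbR : b ∉ insert a R := fun h => by
      rcases Finset.mem_insert.1 h with h | h
      · exact hab h.symm
      · simpa using hR h
    have hC : (Finset.univ \ insert a R).card = m + 2 - R.card := by
      rw [Finset.card_sdiff_of_subset (Finset.subset_univ _), Finset.card_univ, hm,
        Finset.card_insert_of_notMem haR]
      lia
    have heq : ({ω | ¬ ω.ReachIn Finset.univ a s} ∩ {ω | ¬ ω.ReachIn Finset.univ s b}) ∩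
          clusterEvent Finset.univ a (insert a R)
        = clusterEvent Finset.univ a (insert a R) ∩
          {ω | ¬ ω.ReachIn (Finset.univ \ insert a R) s b} := by
      ext ω
      have hinto : ω ∈ clusterEvent Finset.univ a (insert a R) →
          ω ∈ intoEvent (insert a R) (Finset.univ \ insert a R) := fun h => by
        rw [clusterEvent_eq (Finset.mem_insert_self a R) (Finset.subset_univ _)] at h
        exact h.2
      constructor
      · rintro ⟨⟨_, h2⟩, h3⟩
        exact ⟨h3, fun h => h2 ((reachIn_sdiff_iff (hinto h3) hbR).2 h)⟩
      · rintro ⟨h3, h2⟩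
        exact ⟨⟨fun h => hsR ((h3 s).1 h),
          fun h => h2 ((reachIn_sdiff_iff (hinto h3) hbR).1 h)⟩, h3⟩
    have hdep : DependsOn (· ∈ clusterEvent Finset.univ a (insert a R))
        (innerEdges (insert a R) ∪ crossEdges (insert a R) (Finset.univ \ insert a R)) := by
      rw [clusterEvent_eq (Finset.mem_insert_self a R) (Finset.subset_univ _)]
      exact (dependsOn_spanEvent _ _).mem_inter (dependsOn_intoEvent _ _)
    rw [heq, real_inter_of_dependsOn hdep (dependsOn_not_reachIn _ s b),
      real_not_reachIn (m := m - R.card) (by simpa using hsR) (by simpa using hbR) hsb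
        (by lia),
      real_clusterEvent (Finset.mem_insert_self a R) (Finset.subset_univ _),
      real_spanEvent R a haR, hC, Finset.card_insert_of_notMem haR]
    rw [Set.disjoint_union_left]
    exact ⟨disjoint_innerEdges Finset.disjoint_sdiff,
      (disjoint_innerEdges_crossEdges_right Finset.sdiff_disjoint).symm⟩
  rw [real_eq_sum_cluster (S := Finset.univ) haT, Finset.sum_congr rfl h1,
    Finset.sum_powerset_apply_card (fun k => (spanProb k : ℝ) *
      (1 / 2) ^ ((k + 1) * (m + 2 - k)) * noReachProb (m - k)), hT, noReachNoReachProb]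
  · push_cast
    simp [nsmul_eq_mul]
  · rintro ω ⟨hω, hω'⟩ z hz
    rw [Finset.mem_insert, Finset.mem_sdiff]
    by_cases hza : z = a
    · exact Or.inl hza
    · refine Or.inr ⟨Finset.mem_univ _, ?_⟩
      have hzs : z ≠ s := fun h => hω (h ▸ hz)
      -- If `a` reached `b`, either direction of the edge `sb` would violate one of the two events.
      have hzb : z ≠ b := by
        rintro rfl
        rcases EdgeOrientation.arc_or_arc (ω := ω) hsb with h | h
        · exact hω' (.single ⟨Finset.mem_univ _, Finset.mem_univ _, h⟩)
        · exact hω (hz.tail ⟨Finset.mem_univ _, Finset.mem_univ _, h⟩)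
      simp [hza, hzs, hzb]

end Formulas

/-! ### Numerical estimates -/

section Estimates

/-- The subtraction in the recursion hides these bounds; they come from its meaning as a
probability. -/
lemma spanProb_mem_Icc (m : ℕ) : spanProb m ∈ Set.Icc 0 1 := by
  have h := real_spanEvent (V := Fin (m + 1)) (Finset.univ.erase 0) 0 (by simp)
  rw [Finset.card_erase_of_mem (Finset.mem_univ _), Finset.card_univ, Fintype.card_fin,
    Nat.add_sub_cancel] at h
  constructor
  · exact_mod_cast h ▸ measureReal_nonneg
  · exact_mod_cast h ▸ measureReal_le_one

lemma half_pow_le {a b : ℕ} (h : b ≤ a) : (1 / 2 : ℚ) ^ a ≤ (1 / 2) ^ b :=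
  pow_le_pow_of_le_one (by norm_num) (by norm_num) h

lemma spanProb_mul_le {k a b : ℕ} (h : b ≤ a) :
    spanProb k * (1 / 2 : ℚ) ^ a ≤ (1 / 2) ^ b := by
  have h1 := spanProb_mem_Icc k
  have h2 : (0 : ℚ) ≤ (1 / 2) ^ a := by positivity
  nlinarith [half_pow_le h, h1.1, h1.2]

/-- The terms `k = 0` and `k = m - 1` contribute at most `1 + m` times `(1 / 2) ^ m`. Elsewhere the
exponent is at least `2 * m - 2`, so the binomial sum `2 ^ m` adds at most `4 * (1 / 2) ^ m`. -/
lemma one_sub_spanProb_le {m : ℕ} (hm : 2 ≤ m) :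
    1 - spanProb m ≤ (m + 5) * (1 / 2) ^ m := by
  have hterm : ∀ k ∈ Finset.range m,
      (m.choose k : ℚ) * (spanProb k * (1 / 2) ^ ((k + 1) * (m - k)))
        ≤ m.choose k * (1 / 2) ^ (2 * m - 2) + (if k = 0 then (1 / 2) ^ m else 0)
          + (if k = m - 1 then (m : ℚ) * (1 / 2) ^ m else 0) := by
    intro k hk
    rw [Finset.mem_range] at hk
    by_cases h0 : k = 0
    · subst h0
      have h1 : spanProb 0 * (1 / 2 : ℚ) ^ ((0 + 1) * (m - 0)) ≤ (1 / 2) ^ m :=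
        spanProb_mul_le (by simp)
      have h2 : (0 : ℚ) ≤ if 0 = m - 1 then (m : ℚ) * (1 / 2) ^ m else 0 := by positivity
      have h3 : (0 : ℚ) ≤ (1 / 2) ^ (2 * m - 2) := by positivity
      simp only [Nat.choose_zero_right, Nat.cast_one, one_mul, if_true] at *
      linarith
    by_cases h1 : k = m - 1
    · have h1' : spanProb k * (1 / 2 : ℚ) ^ ((k + 1) * (m - k)) ≤ (1 / 2) ^ m :=
        spanProb_mul_le (by rw [show k + 1 = m by lia, show m - k = 1 by lia]; simp)
      have hc : m.choose k = m := by
        rw [h1, Nat.choose_symm (n := m) (k := 1) (by lia), Nat.choose_one_right]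
      have h3 : (0 : ℚ) ≤ m * (1 / 2) ^ (2 * m - 2) := by positivity
      have h4 : (0 : ℚ) ≤ m := by positivity
      rw [if_neg h0, if_pos h1, hc]
      nlinarith
    · rw [if_neg h0, if_neg h1, add_zero, add_zero]
      gcongr
      refine spanProb_mul_le ?_
      obtain ⟨i, rfl⟩ : ∃ i, k = i + 1 := ⟨k - 1, by lia⟩
      obtain ⟨j, rfl⟩ : ∃ j, m = i + 1 + (j + 2) := ⟨m - i - 3, by lia⟩
      rw [Nat.add_sub_cancel_left]
      have : 2 * (i + 1 + (j + 2)) - 2 = 2 * i + 2 * j + 4 := by lia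
      rw [this]
      nlinarith
  have hsum : (∑ k ∈ Finset.range m, (m.choose k : ℚ)) ≤ 2 ^ m := by
    have := Nat.sum_range_choose m
    rw [Finset.sum_range_succ] at this
    exact_mod_cast (by lia : ∑ k ∈ Finset.range m, m.choose k ≤ 2 ^ m)
  have h := Finset.sum_le_sum hterm
  rw [Finset.sum_add_distrib, Finset.sum_add_distrib, ← Finset.sum_mul, Finset.sum_ite_eq',
    Finset.sum_ite_eq', if_pos (Finset.mem_range.2 (by lia)),
    if_pos (Finset.mem_range.2 (by lia))] at h
  have hpow : (2 : ℚ) ^ m * (1 / 2) ^ (2 * m - 2) = 4 * (1 / 2) ^ m := by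
    obtain ⟨j, rfl⟩ : ∃ j, m = j + 1 := ⟨m - 1, by lia⟩
    have hj : (2 : ℚ) ^ j * (1 / 2) ^ j = 1 := by rw [← mul_pow]; norm_num
    rw [show 2 * (j + 1) - 2 = j + j by lia]
    linear_combination 2 * (1 / 2 : ℚ) ^ j * hj
  have h5 := mul_le_mul_of_nonneg_right hsum (by positivity : (0 : ℚ) ≤ (1 / 2) ^ (2 * m - 2))
  rw [spanProb, Fin.sum_univ_eq_sum_range
    (fun k => (m.choose k : ℚ) * (spanProb k * (1 / 2) ^ ((k + 1) * (m - k)))) m]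
  linarith

/-- The end terms `k = 0, m` give the main part. The terms `k = 1, m - 1` give at most `m * (1 / 2)
^ (2 * m)` each, and all others, with exponent at least `3 * m - 3`, together at most `8 * (1 / 2) ^
(2 * m)`. -/
lemma noReachProb_le {m : ℕ} (hm : 4 ≤ m) :
    noReachProb m ≤ (1 / 2) ^ m * (1 + (2 * m + 8) * (1 / 2) ^ m) := by
  have hterm : ∀ k ∈ Finset.range (m + 1),
      (m.choose k : ℚ) * (spanProb k * (1 / 2) ^ ((k + 1) * (m + 1 - k)))
        ≤ m.choose k * (1 / 2) ^ (3 * m - 3) + (if k = 0 then (1 / 2) ^ (m + 1) else 0)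
          + (if k = m then (1 / 2) ^ (m + 1) else 0)
          + (if k = 1 then (m : ℚ) * (1 / 2) ^ (2 * m) else 0)
          + (if k = m - 1 then (m : ℚ) * (1 / 2) ^ (2 * m) else 0) := by
    intro k hk
    rw [Finset.mem_range] at hk
    have hpos : (0 : ℚ) ≤ m.choose k * (1 / 2) ^ (3 * m - 3) := by positivity
    have hends : ∀ {c b : ℕ}, m.choose k = c → b ≤ (k + 1) * (m + 1 - k) →
        (m.choose k : ℚ) * (spanProb k * (1 / 2) ^ ((k + 1) * (m + 1 - k))) ≤ c * (1 / 2) ^ b := by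
      rintro c b rfl h
      exact mul_le_mul_of_nonneg_left (spanProb_mul_le h) (by positivity)
    by_cases h0 : k = 0
    · rw [if_pos h0, if_neg (by lia), if_neg (by lia), if_neg (by lia)]
      have := hends (c := 1) (b := m + 1) (by simp [h0]) (by simp [h0])
      push_cast at this
      linarith
    by_cases h1 : k = m
    · rw [if_neg h0, if_pos h1, if_neg (by lia), if_neg (by lia)]
      have := hends (c := 1) (b := m + 1) (by simp [h1]) (by simp [h1])
      push_cast at this
      linarith
    by_cases h2 : k = 1
    · rw [if_neg h0, if_neg h1, if_pos h2, if_neg (by lia)]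
      have := hends (c := m) (b := 2 * m) (by simp [h2]) (by simp [h2])
      linarith
    by_cases h3 : k = m - 1
    · rw [if_neg h0, if_neg h1, if_neg h2, if_pos h3]
      have := hends (c := m) (b := 2 * m)
        (by rw [h3, Nat.choose_symm (n := m) (k := 1) (by lia), Nat.choose_one_right])
        (by rw [show k + 1 = m by lia, show m + 1 - k = 2 by lia, mul_comm])
      linarith
    · rw [if_neg h0, if_neg h1, if_neg h2, if_neg h3]
      simp only [add_zero]
      refine hends rfl ?_
      obtain ⟨i, rfl⟩ : ∃ i, k = i + 2 := ⟨k - 2, by lia⟩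
      obtain ⟨j, rfl⟩ : ∃ j, m = i + 2 + (j + 2) := ⟨m - i - 4, by lia⟩
      rw [show i + 2 + (j + 2) + 1 - (i + 2) = j + 3 by lia,
        show 3 * (i + 2 + (j + 2)) - 3 = 3 * i + 3 * j + 9 by lia]
      nlinarith
  have h := Finset.sum_le_sum hterm
  have hsum : (∑ k ∈ Finset.range (m + 1), (m.choose k : ℚ)) = 2 ^ m :=
    mod_cast Nat.sum_range_choose m
  simp only [Finset.sum_add_distrib] at h
  rw [← Finset.sum_mul, hsum] at h
  simp only [Finset.sum_ite_eq'] at h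
  rw [if_pos (Finset.mem_range.2 (by lia)), if_pos (Finset.mem_range.2 (by lia)),
    if_pos (Finset.mem_range.2 (by lia)), if_pos (Finset.mem_range.2 (by lia))] at h
  have hpow : (2 : ℚ) ^ m * (1 / 2) ^ (3 * m - 3) = 8 * (1 / 2) ^ m * (1 / 2) ^ m := by
    obtain ⟨j, rfl⟩ : ∃ j, m = j + 1 := ⟨m - 1, by lia⟩
    have hj : (2 : ℚ) ^ j * (1 / 2) ^ j = 1 := by rw [← mul_pow]; norm_num
    rw [show 3 * (j + 1) - 3 = j + j + j by lia]
    linear_combination 2 * ((1 / 2 : ℚ) ^ j) ^ 2 * hj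
  rw [hpow, pow_succ, two_mul m, pow_add] at h
  rw [noReachProb]
  linarith

lemma noReachProb_zero : noReachProb 0 = 1 / 2 := by
  decide +kernel

/-- Keep only two clusters: the source vertex alone, and everything but the target. They coincide
when `m = 0`. -/
lemma le_noReachProb {m : ℕ} (hm : m ≠ 0) :
    (1 / 2) ^ (m + 1) * (1 + spanProb m) ≤ noReachProb m := by
  have hsub : ({0, m} : Finset ℕ) ⊆ Finset.range (m + 1) := by
    simp [Finset.insert_subset_iff]
  have h := Finset.sum_le_sum_of_subset_of_nonneg hsub
    (f := fun k => (m.choose k : ℚ) * (spanProb k * (1 / 2) ^ ((k + 1) * (m + 1 - k))))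
    fun k _ _ => by
      have := (spanProb_mem_Icc k).1
      positivity
  rw [Finset.sum_pair hm.symm] at h
  have h0 : spanProb 0 = 1 := by decide +kernel
  simp only [Nat.choose_zero_right, Nat.choose_self, h0, Nat.cast_one, zero_add, one_mul,
    Nat.sub_zero, Nat.add_sub_cancel_left, mul_one] at h
  rw [noReachProb]
  linarith

/-- If `a` is a sink, `le_noReachProb` applies to the rest and yields `1 + spanProb m`. The second
`spanProb m` comes from the cluster of `a` being everything but `s` and `b`, with the arc `b → s`.
-/
lemma le_noReachNoReachProb {m : ℕ} (hm : m ≠ 0) :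
    (1 / 2) ^ (2 * m + 3) * (1 + 2 * spanProb m) ≤ noReachNoReachProb m := by
  have hp : ∀ k, 0 ≤ noReachProb k := fun k => Finset.sum_nonneg fun i _ => by
    have := (spanProb_mem_Icc i).1
    positivity
  have hsub : ({0, m} : Finset ℕ) ⊆ Finset.range (m + 1) := by
    simp [Finset.insert_subset_iff]
  have h := Finset.sum_le_sum_of_subset_of_nonneg hsub
    (f := fun k => (m.choose k : ℚ) *
      (spanProb k * (1 / 2) ^ ((k + 1) * (m + 2 - k)) * noReachProb (m - k)))
    fun k _ _ => by
      have := (spanProb_mem_Icc k).1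
      have := hp (m - k)
      positivity
  rw [Finset.sum_pair hm.symm] at h
  have h0 : spanProb 0 = 1 := by decide +kernel
  have h1 := mul_le_mul_of_nonneg_left (le_noReachProb hm)
    (by positivity : (0 : ℚ) ≤ (1 / 2) ^ (m + 2))
  have e1 : (1 / 2 : ℚ) ^ (m + 2) * ((1 / 2) ^ (m + 1) * (1 + spanProb m))
      = (1 / 2) ^ (2 * m + 3) * (1 + spanProb m) := by ring
  have e2 : (1 / 2 : ℚ) ^ ((m + 1) * (m + 2 - m)) * (1 / 2) = (1 / 2) ^ (2 * m + 3) := by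
    rw [Nat.add_sub_cancel_left, ← pow_succ]; ring_nf
  rw [Nat.choose_zero_right, Nat.choose_self, h0, Nat.sub_self, noReachProb_zero,
    mul_assoc _ _ (1 / 2 : ℚ), e2, zero_add, one_mul, Nat.sub_zero, Nat.sub_zero] at h
  rw [e1] at h1
  rw [noReachNoReachProb]
  simp only [Nat.cast_one, one_mul] at h
  linarith

lemma mul_half_pow_le {m : ℕ} (hm : 7 ≤ m) : (2 * m + 10) * (1 / 2 : ℚ) ^ m ≤ 3 / 16 := by
  induction m, hm using Nat.le_induction with
  | base => norm_num
  | succ m hm ih =>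
    have : (0 : ℚ) < (1 / 2) ^ m := by positivity
    have : (7 : ℚ) ≤ m := by exact_mod_cast hm
    rw [pow_succ]
    push_cast
    nlinarith

lemma sq_noReachProb_lt {m : ℕ} (hm : 2 ≤ m) :
    noReachProb (m + 1) ^ 2 < noReachNoReachProb m := by
  rcases le_or_gt m 6 with h6 | h6
  -- The estimate below is too weak here: already at `m = 6` it has `x = 11 / 32`, violating the
  -- required `x ^ 2 + 6 * x < 2`.
  · have : ∀ m ∈ Finset.Icc 2 6, noReachProb (m + 1) ^ 2 < noReachNoReachProb m := by
      decide +kernel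
    exact this m (Finset.mem_Icc.2 ⟨hm, h6⟩)
  set y : ℚ := (1 / 2) ^ m with hy
  have hy0 : 0 < y := by positivity
  set x : ℚ := (2 * m + 10) * y with hx
  have hx0 : 0 ≤ x := by positivity
  have hx1 : x ≤ 3 / 16 := mul_half_pow_le (by lia)
  have h1 : noReachProb (m + 1) ≤ y / 4 * (2 + x) := by
    refine (noReachProb_le (by lia)).trans_eq ?_
    rw [hx, pow_succ, ← hy]
    push_cast
    ring
  have h0 : 0 ≤ noReachProb (m + 1) := Finset.sum_nonneg fun i _ => by
    have := (spanProb_mem_Icc i).1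
    positivity
  have h2 : 1 - x / 2 ≤ spanProb m := by
    have := one_sub_spanProb_le hm
    rw [hx]
    linarith
  calc noReachProb (m + 1) ^ 2 ≤ (y / 4 * (2 + x)) ^ 2 := by gcongr
    _ = y ^ 2 / 16 * (2 + x) ^ 2 := by ring
    -- After cancelling, this is `(2 + x) ^ 2 < 6 - 2 * x`, that is `x ^ 2 + 6 * x < 2`, which holds
    -- for `0 ≤ x ≤ 3 / 16`.
    _ < y ^ 2 / 16 * (2 * (1 + 2 * (1 - x / 2))) := by
      gcongr
      nlinarith
    _ ≤ y ^ 2 / 16 * (2 * (1 + 2 * spanProb m)) := by gcongr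
    _ = (1 / 2) ^ (2 * m + 3) * (1 + 2 * spanProb m) := by rw [hy]; ring
    _ ≤ _ := le_noReachNoReachProb (by lia)

end Estimates

/-! ### The correlation -/

section Correlation

lemma real_compl_inter_compl_sub {Ω : Type*} [MeasurableSpace Ω] {P : Measure Ω}
    [IsProbabilityMeasure P] {E F : Set Ω} (hE : MeasurableSet E) (hF : MeasurableSet F) :
    P.real (Eᶜ ∩ Fᶜ) - P.real Eᶜ * P.real Fᶜ = P.real (E ∩ F) - P.real E * P.real F := by
  have h := measureReal_union_add_inter (μ := P) (s := E) hF
  rw [← Set.compl_union, probReal_compl_eq_one_sub (hE.union hF), probReal_compl_eq_one_sub hE,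
    probReal_compl_eq_one_sub hF]
  linear_combination -h

lemma indepSet_of_real {Ω : Type*} [MeasurableSpace Ω] {P : Measure Ω}
    [IsProbabilityMeasure P] {E F : Set Ω} (hE : MeasurableSet E) (hF : MeasurableSet F)
    (h : P.real (E ∩ F) = P.real E * P.real F) : IndepSet E F P := by
  rw [indepSet_iff_measure_inter_eq_mul hE hF P,
    ← ENNReal.toReal_eq_toReal_iff' (measure_ne_top _ _)
      (ENNReal.mul_ne_top (measure_ne_top _ _) (measure_ne_top _ _)), ENNReal.toReal_mul]
  exact h

lemma pathEvent_eq_compl {V : Type*} (G : SimpleGraph V) (u v : V) :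
    pathEvent G u v = (noPathEvent G u v)ᶜ := by
  ext; simp [pathEvent, noPathEvent]

lemma noPathEvent_top_eq {V : Type*} [Fintype V] (u v : V) :
    noPathEvent (⊤ : SimpleGraph V) u v = {ω | ¬ ω.ReachIn Finset.univ u v} := by
  ext; simp [noPathEvent, reachIn_univ]

end Correlation

theorem theorem3p6 (n : ℕ) (a s b : Fin n) (has : a ≠ s) (hsb : s ≠ b) (hab : a ≠ b) :
    (n = 3 →
      NegativelyCorrelated (randomOrientation (K n))
          (noPathEvent (K n) a s) (noPathEvent (K n) s b) ∧
        NegativelyCorrelated (randomOrientation (K n))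
          (pathEvent (K n) a s) (pathEvent (K n) s b)) ∧
    (n = 4 →
      IndepSet (noPathEvent (K n) a s) (noPathEvent (K n) s b)
          (randomOrientation (K n)) ∧
        IndepSet (pathEvent (K n) a s) (pathEvent (K n) s b)
          (randomOrientation (K n))) ∧
    (5 ≤ n →
      PositivelyCorrelated (randomOrientation (K n))
          (noPathEvent (K n) a s) (noPathEvent (K n) s b) ∧
        PositivelyCorrelated (randomOrientation (K n))
          (pathEvent (K n) a s) (pathEvent (K n) s b)) := by
  have hn : 3 ≤ n := by
    simpa [Finset.card_eq_three.2 ⟨a, s, b, has, hab, hsb, rfl⟩] using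
      Finset.card_le_univ ({a, s, b} : Finset (Fin n))
  obtain ⟨m, rfl⟩ : ∃ m, n = m + 3 := ⟨n - 3, by lia⟩
  have hA : (randomOrientation (K (m + 3))).real (noPathEvent (K (m + 3)) a s)
      = noReachProb (m + 1) := by
    rw [noPathEvent_top_eq]
    exact real_not_reachIn (Finset.mem_univ _) (Finset.mem_univ _) has (by simp)
  have hB : (randomOrientation (K (m + 3))).real (noPathEvent (K (m + 3)) s b)
      = noReachProb (m + 1) := by
    rw [noPathEvent_top_eq]
    exact real_not_reachIn (Finset.mem_univ _) (Finset.mem_univ _) hsb (by simp)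
  have hAB : (randomOrientation (K (m + 3))).real
      (noPathEvent (K (m + 3)) a s ∩ noPathEvent (K (m + 3)) s b) = noReachNoReachProb m := by
    rw [noPathEvent_top_eq, noPathEvent_top_eq]
    exact real_not_reachIn_inter has hsb hab (by simp)
  have hcov := real_compl_inter_compl_sub (P := randomOrientation (K (m + 3)))
    (measurableSet_orientation (noPathEvent (K (m + 3)) a s))
    (measurableSet_orientation (noPathEvent (K (m + 3)) s b))
  rw [← pathEvent_eq_compl, ← pathEvent_eq_compl] at hcov
  refine ⟨fun h => ?_, fun h => ?_, fun h => ?_⟩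
  · obtain rfl : m = 0 := by lia
    have hlt : noReachNoReachProb 0 < noReachProb (0 + 1) * noReachProb (0 + 1) := by
      decide +kernel
    have hneg : NegativelyCorrelated (randomOrientation (K (0 + 3)))
        (noPathEvent (K (0 + 3)) a s) (noPathEvent (K (0 + 3)) s b) := by
      rw [NegativelyCorrelated, hA, hB, hAB]
      exact_mod_cast hlt
    refine ⟨hneg, ?_⟩
    rw [NegativelyCorrelated] at hneg ⊢
    linarith
  · obtain rfl : m = 1 := by lia
    have heq : noReachNoReachProb 1 = noReachProb (1 + 1) * noReachProb (1 + 1) := by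
      decide +kernel
    have hzero : (randomOrientation (K (1 + 3))).real
        (noPathEvent (K (1 + 3)) a s ∩ noPathEvent (K (1 + 3)) s b)
        = (randomOrientation (K (1 + 3))).real (noPathEvent (K (1 + 3)) a s) *
          (randomOrientation (K (1 + 3))).real (noPathEvent (K (1 + 3)) s b) := by
      rw [hA, hB, hAB]
      exact_mod_cast heq
    exact ⟨indepSet_of_real (measurableSet_orientation _) (measurableSet_orientation _) hzero,
      indepSet_of_real (measurableSet_orientation _) (measurableSet_orientation _) (by linarith)⟩
  · have hlt := sq_noReachProb_lt (m := m) (by lia)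
    rw [sq] at hlt
    have hpos : PositivelyCorrelated (randomOrientation (K (m + 3)))
        (noPathEvent (K (m + 3)) a s) (noPathEvent (K (m + 3)) s b) := by
      rw [PositivelyCorrelated, hA, hB, hAB]
      exact_mod_cast hlt
    refine ⟨hpos, ?_⟩
    rw [PositivelyCorrelated] at hpos ⊢
    linarith
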